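/- Let $BC\cap\mathrm{Lip}_0$ denote the bounded, Lipschitz continuous functions $\phi:[0,\infty)\to\mathbb R$ with $\phi(0)=0$. Consider the coagulation–fragmentation equation with kernels $a(s,\hat s)=s\hat s$ and $b(s,\hat s)=1$. A family $(\mu_t)_{t\ge0}$ of positive Radon measures on $(0,\infty)$ with finite mass $m_1(t)=\int_0^\infty s\,\mu_t(ds)<\infty$ for all $t\ge 0$ is a *weak solution in the measure sense* if for every $\phi\in BC\cap\mathrm{Lip}_0$ the function $t\mapsto\int_0^\infty\phi\,d\mu_t$ is continuous at $t=0$ (from the right) and, for all $t>0$, is differentiable with $$\frac{d}{dt}\int_0^\infty\phi(s)\,\mu_t(ds)=\frac12\int_0^\infty\!\!\int_0^\infty\big(\phi(s+\hat s)-\phi(s)-\phi(\hat s)\big)s\hat s\,\mu_t(d\hat s)\,\mu_t(ds)-\frac12\int_0^\infty\Big(\int_0^s\big(\phi(s)-\phi(\hat s)-\phi(s-\hat s)\big)d\hat s\Big)\mu_t(ds).$$ A *solution* is a function $c(s,t)\ge0$, $s>0$, $t\ge0$, measurable in $s$, such that $\mu_t(ds)=c(s,t)\,ds$ satisfies the same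 requirements; densities are identified when they agree for a.e. $s$. A solution of either kind is *mass-conserving* if $m_1(t)=m_1(0)$ for all $t\ge0$. **Corollary.** Let $0<m\le1$. 1. For every initial datum $c_0$ with $\int_0^\infty s\,c_0(s)\,ds=m$ there is at most one mass-conserving solution with $c(\cdot,0)=c_0$: if $c$ and $d$ are two of them, then for every $t\ge0$, $c(s,t)=d(s,t)$ for a.e. $s>0$. 2. For every positive Radon measure $\mu_0$ on $(0,\infty)$ with $\int_0^\infty s\,\mu_0(ds)=m$ there is at most one mass-conserving weak solution in the measure sense with initial value $\mu_0$: if $(\mu_t)$ and $(\nu_t)$ are two of them, then $\mu_t=\nu_t$ for every $t\ge0$. -/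

import Mathlib

open Set MeasureTheory

namespace CoagFrag

/-- Admissible test functions: `φ ∈ BC([0,∞)) ∩ Lip([0,∞))` with `φ(0) = 0`.
Only the values of `φ` on `[0,∞)` matter. -/
structure IsTestFunction (φ : ℝ → ℝ) : Prop where
  continuousOn : ContinuousOn φ (Ici 0)
  bounded : ∃ B : ℝ, ∀ s ∈ Ici (0 : ℝ), |φ s| ≤ B
  lipschitz : ∃ K : NNReal, LipschitzOnWith K φ (Ici 0)
  map_zero : φ 0 = 0

/-! Densities `c s t`: size `s > 0`, time `t ≥ 0`. -/

/-- The total mass `m₁(t) = ∫₀^∞ s c(s,t) ds`, as an element of `[0,∞]`. -/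
noncomputable def mass (c : ℝ → ℝ → ℝ) (t : ℝ) : ENNReal :=
  ∫⁻ s in Ioi (0 : ℝ), ENNReal.ofReal (s * c s t)

/-- The right-hand side of the weak coagulation-fragmentation equation with kernels
`a(s,r) = s * r` and `b(s,r) = 1`, tested against `φ`, at time `t`. -/
noncomputable def weakRHS (c : ℝ → ℝ → ℝ) (φ : ℝ → ℝ) (t : ℝ) : ℝ :=
  (1 / 2) * (∫ s in Ioi (0 : ℝ), ∫ r in Ioi (0 : ℝ),
      (φ (s + r) - φ s - φ r) * (s * c s t) * (r * c r t))
    - (1 / 2) * (∫ s in Ioi (0 : ℝ), (∫ r in (0 : ℝ)..s, (φ s - φ r - φ (s - r))) * c s t)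

/-- `c` is a (weak) solution, with finite mass at every time, of the
coagulation-fragmentation equation on the time interval `[0,∞)`. The time derivative is taken
at positive times, and the initial value is attained continuously. -/
structure IsSolution (c : ℝ → ℝ → ℝ) : Prop where
  aemeasurable : ∀ t, 0 ≤ t → AEMeasurable (fun s => c s t) (volume.restrict (Ioi 0))
  nonneg : ∀ t, 0 ≤ t → ∀ᵐ s ∂(volume.restrict (Ioi (0 : ℝ))), 0 ≤ c s t
  mass_ne_top : ∀ t, 0 ≤ t → mass c t ≠ ⊤
  hasDerivAt : ∀ φ, IsTestFunction φ → ∀ t, 0 < t →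
    HasDerivAt (fun τ => ∫ s in Ioi (0 : ℝ), φ s * c s τ) (weakRHS c φ t) t
  continuous_at_zero : ∀ φ, IsTestFunction φ →
    ContinuousWithinAt (fun τ => ∫ s in Ioi (0 : ℝ), φ s * c s τ) (Ici 0) 0

/-- A solution whose mass stays equal to its initial mass. -/
structure IsMassConservingSolution (c : ℝ → ℝ → ℝ) : Prop extends IsSolution c where
  mass_eq : ∀ t, 0 ≤ t → mass c t = mass c 0

/-! Families `μ t`, `t ≥ 0`, of positive Radon measures on `(0,∞)`, regarded as Borel
measures on the line that are concentrated on `(0,∞)`. -/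

/-- The total mass `∫ s μ_t(ds)`, as an element of `[0,∞]`. -/
noncomputable def measureMass (μ : ℝ → Measure ℝ) (t : ℝ) : ENNReal :=
  ∫⁻ s in Ioi (0 : ℝ), ENNReal.ofReal s ∂(μ t)

/-- The right-hand side of the weak coagulation-fragmentation equation with kernels
`a(s,r) = s * r` and `b(s,r) = 1`, for a family of measures. -/
noncomputable def measureWeakRHS (μ : ℝ → Measure ℝ) (φ : ℝ → ℝ) (t : ℝ) : ℝ :=
  (1 / 2) * (∫ s in Ioi (0 : ℝ), ∫ r in Ioi (0 : ℝ),
      (φ (s + r) - φ s - φ r) * (s * r) ∂(μ t) ∂(μ t))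
    - (1 / 2) * (∫ s in Ioi (0 : ℝ), (∫ r in (0 : ℝ)..s, (φ s - φ r - φ (s - r))) ∂(μ t))

/-- `μ` is a weak solution in the measure sense, with finite mass at every time, of the
coagulation-fragmentation equation on the time interval `[0,∞)`. (On `(0,∞)`, a Borel measure
that is finite on compact sets is a Radon measure.) -/
structure IsMeasureSolution (μ : ℝ → Measure ℝ) : Prop where
  concentrated : ∀ t, 0 ≤ t → μ t (Iic 0) = 0
  finite_on_compacts : ∀ t, 0 ≤ t → ∀ K ⊆ Ioi (0 : ℝ), IsCompact K → μ t K ≠ ⊤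
  mass_ne_top : ∀ t, 0 ≤ t → measureMass μ t ≠ ⊤
  hasDerivAt : ∀ φ, IsTestFunction φ → ∀ t, 0 < t →
    HasDerivAt (fun τ => ∫ s in Ioi (0 : ℝ), φ s ∂(μ τ)) (measureWeakRHS μ φ t) t
  continuous_at_zero : ∀ φ, IsTestFunction φ →
    ContinuousWithinAt (fun τ => ∫ s in Ioi (0 : ℝ), φ s ∂(μ τ)) (Ici 0) 0

/-- A measure-valued weak solution whose mass stays equal to its initial mass. -/
structure IsMassConservingMeasureSolution (μ : ℝ → Measure ℝ) : Prop
    extends IsMeasureSolution μ where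
  mass_eq : ∀ t, 0 ≤ t → measureMass μ t = measureMass μ 0

end CoagFrag

/-!
Testing against `s ↦ 1 - exp (-(x * s))` turns a solution of mass `m` into its Bernstein transform
`U(x, t)`, which satisfies the first-order equation
`U_t = -(m - U_x)² / 2 + (m + U_x) / 2 - U / x`.
The difference `w` of two such transforms satisfies `w_t + b w_x + w / x = 0`, where
`b = (U_x + V_x) / 2 - m - 1/2` is bounded below because `U` and `V` are nondecreasing in `x`.
Together with `w ≤ m x`, this one-sided bound suffices for a maximum principle, so `w ≤ 0`, and by
symmetry `w = 0`. Finally `U_x` is the Laplace transform of the finite measure `s μ_t(ds)`, which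
therefore determines `μ_t`.
-/

open Filter Topology ProbabilityTheory

namespace CoagFrag

section MaximumPrinciple

lemma nonneg_of_hasDerivAt_of_isMaxOn_Icc {f : ℝ → ℝ} {f' a t : ℝ} (hat : a < t)
    (hf : HasDerivAt f f' t) (hmax : IsMaxOn f (Icc a t) t) : 0 ≤ f' := by
  have hcone : a - t ∈ posTangentConeAt (Icc a t) t :=
    sub_mem_posTangentConeAt_of_segment_subset (by rw [segment_symm, segment_eq_Icc hat.le])
  have h : (a - t) * f' ≤ 0 := by
    simpa using hmax.localize.hasFDerivWithinAt_nonpos hf.hasDerivWithinAt.hasFDerivWithinAt hcone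
  exact nonneg_of_mul_nonpos_right h (sub_neg.2 hat)

lemma exists_isMaxOn_of_pos {X : Type*} [TopologicalSpace X] {Ω K : Set X} {ψ : X × ℝ → ℝ}
    {p : X × ℝ} (hK : IsCompact K) (hKΩ : K ⊆ Ω) (hψ : ContinuousOn ψ (Ω ×ˢ Ici 0))
    (hout : ∀ x ∈ Ω \ K, ∀ t, 0 ≤ t → ψ (x, t) ≤ 0) (hp : p ∈ Ω ×ˢ Ici 0) (hpos : 0 < ψ p) :
    ∃ q ∈ Ω ×ˢ Ici 0, 0 < ψ q ∧ IsMaxOn ψ (Ω ×ˢ Icc 0 q.2) q := by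
  have hpK : p ∈ K ×ˢ Icc 0 p.2 :=
    ⟨by_contra fun h => (hout p.1 ⟨hp.1, h⟩ p.2 hp.2).not_gt hpos, hp.2, le_rfl⟩
  obtain ⟨q, hq, hmax⟩ := (hK.prod isCompact_Icc).exists_isMaxOn ⟨p, hpK⟩
    (hψ.mono (prod_mono hKΩ Icc_subset_Ici_self))
  have hqpos : 0 < ψ q := hpos.trans_le (hmax hpK)
  refine ⟨q, ⟨hKΩ hq.1, hq.2.1⟩, hqpos, fun z hz => ?_⟩
  by_cases hzK : z.1 ∈ K
  · exact hmax ⟨hzK, hz.2.1, hz.2.2.trans hq.2.2⟩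
  · exact (hout z.1 ⟨hz.1, hzK⟩ z.2 hz.2.1).trans hqpos.le

lemma nonpos_of_transport_neg {Ω K : Set ℝ} {ψ ψx ψt b : ℝ → ℝ → ℝ} (hΩ : IsOpen Ω)
    (hK : IsCompact K) (hKΩ : K ⊆ Ω) (hcont : ContinuousOn (fun p => ψ p.1 p.2) (Ω ×ˢ Ici (0 : ℝ)))
    (hout : ∀ x ∈ Ω \ K, ∀ t, 0 ≤ t → ψ x t ≤ 0) (h0 : ∀ x ∈ Ω, ψ x 0 ≤ 0)
    (hx : ∀ x ∈ Ω, ∀ t, 0 < t → HasDerivAt (fun y => ψ y t) (ψx x t) x)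
    (ht : ∀ x ∈ Ω, ∀ t, 0 < t → HasDerivAt (ψ x) (ψt x t) t)
    (hneg : ∀ x ∈ Ω, ∀ t, 0 < t → 0 < ψ x t → ψt x t + b x t * ψx x t < 0)
    {x t : ℝ} (hxΩ : x ∈ Ω) (ht0 : 0 ≤ t) : ψ x t ≤ 0 := by
  by_contra! hpos
  obtain ⟨⟨y, s⟩, ⟨hy, hs⟩, hypos, hmax⟩ :=
    exists_isMaxOn_of_pos (p := (x, t)) hK hKΩ hcont hout ⟨hxΩ, ht0⟩ hpos
  have hs0 : 0 < s := (mem_Ici.1 hs).lt_of_ne (by rintro rfl; exact (h0 y hy).not_gt hypos)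
  have hlocal : IsLocalMax (fun z => ψ z s) y := by
    filter_upwards [hΩ.mem_nhds hy] with z hz
    exact isMaxOn_iff.1 hmax (z, s) ⟨hz, hs, le_rfl⟩
  have hψx : ψx y s = 0 := hlocal.hasDerivAt_eq_zero (hx y hy s hs0)
  have hψt : 0 ≤ ψt y s :=
    nonneg_of_hasDerivAt_of_isMaxOn_Icc hs0 (ht y hy s hs0) fun τ hτ =>
      isMaxOn_iff.1 hmax (y, τ) ⟨hy, hτ⟩
  have := hneg y hy s hs0 hypos
  rw [hψx, mul_zero, add_zero] at this
  exact this.not_ge hψt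

/-- A barrier for the transport equation `w_t + b w_x = 0` on the half-line: if `b` is bounded
below and `k` is large, it is a strict supersolution, and it outgrows any `M x` at both ends of
`(0,∞)`. -/
noncomputable def barrier (k x t : ℝ) : ℝ :=
  Real.exp (k * t) * (1 + x ^ 2)

lemma barrier_pos (k x t : ℝ) : 0 < barrier k x t := by
  unfold barrier
  positivity

lemma hasDerivAt_barrier_space (k x t : ℝ) :
    HasDerivAt (fun y => barrier k y t) (Real.exp (k * t) * (2 * x)) x := by
  simpa [barrier] using ((hasDerivAt_pow 2 x).const_add 1).const_mul (Real.exp (k * t))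

lemma hasDerivAt_barrier_time (k x t : ℝ) : HasDerivAt (barrier k x) (k * barrier k x t) t := by
  convert! (((hasDerivAt_id t).const_mul k).exp).mul_const (1 + x ^ 2) using 1
  simp only [barrier, id_eq, mul_one]
  ring

lemma barrier_strict_supersolution {B b x : ℝ} (hb : -B ≤ b) (hx : 0 ≤ x) (t : ℝ) :
    0 < (|B| + 1) * barrier (|B| + 1) x t + b * (Real.exp ((|B| + 1) * t) * (2 * x)) := by
  have hb' : -|B| * (2 * x) ≤ b * (2 * x) :=
    mul_le_mul_of_nonneg_right ((neg_le_neg (le_abs_self B)).trans hb) (by positivity)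
  have hsq : 0 ≤ |B| * (x - 1) ^ 2 := by positivity
  have hfactor : 0 < (|B| + 1) * (1 + x ^ 2) + b * (2 * x) := by nlinarith
  have := mul_pos (Real.exp_pos ((|B| + 1) * t)) hfactor
  unfold barrier
  linarith

lemma exists_isCompact_forall_mul_le_barrier {δ k : ℝ} (hδ : 0 < δ) (hk : 0 ≤ k) (M : ℝ) :
    ∃ K ⊆ Ioi (0 : ℝ), IsCompact K ∧
      ∀ x ∈ Ioi (0 : ℝ) \ K, ∀ t, 0 ≤ t → M * x ≤ δ * barrier k x t := by
  refine ⟨Icc 0 (M / δ) ∩ {x | δ * (1 + x ^ 2) ≤ M * x}, ?_, ?_, ?_⟩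
  · rintro x ⟨hx, hle⟩
    refine hx.1.lt_of_ne ?_
    rintro rfl
    simp only [mem_ofPred_eq] at hle
    linarith
  · exact isCompact_Icc.inter_right (isClosed_le (by fun_prop) (by fun_prop))
  · rintro x ⟨hx, hxK⟩ t ht
    have hx : 0 < x := hx
    have hinitial : M * x ≤ δ * (1 + x ^ 2) := by
      by_contra! hlt
      refine hxK ⟨⟨hx.le, (le_div_iff₀ hδ).2 ?_⟩, hlt.le⟩
      nlinarith
    have hexp : 1 ≤ Real.exp (k * t) := Real.one_le_exp (by positivity)
    exact hinitial.trans
      (mul_le_mul_of_nonneg_left (le_mul_of_one_le_left (by positivity) hexp) hδ.le)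

lemma nonpos_of_transport_nonpos {w wx wt b : ℝ → ℝ → ℝ} {M B : ℝ}
    (hcont : ContinuousOn (fun p => w p.1 p.2) (Ioi (0 : ℝ) ×ˢ Ici (0 : ℝ)))
    (hbound : ∀ x, 0 < x → ∀ t, 0 ≤ t → w x t ≤ M * x) (h0 : ∀ x, 0 < x → w x 0 ≤ 0)
    (hx : ∀ x, 0 < x → ∀ t, 0 < t → HasDerivAt (fun y => w y t) (wx x t) x)
    (ht : ∀ x, 0 < x → ∀ t, 0 < t → HasDerivAt (w x) (wt x t) t)
    (hb : ∀ x, 0 < x → ∀ t, 0 < t → -B ≤ b x t)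
    (hw : ∀ x, 0 < x → ∀ t, 0 < t → 0 < w x t → wt x t + b x t * wx x t ≤ 0)
    {x t : ℝ} (hx0 : 0 < x) (ht0 : 0 ≤ t) : w x t ≤ 0 := by
  set k := |B| + 1
  suffices h : ∀ δ > 0, w x t - δ * barrier k x t ≤ 0 by
    have hlim : Tendsto (fun δ => w x t - δ * barrier k x t) (𝓝[>] 0) (𝓝 (w x t)) :=
      (Continuous.tendsto' (by fun_prop) 0 _ (by simp)).mono_left nhdsWithin_le_nhds
    exact le_of_tendsto hlim (by filter_upwards [self_mem_nhdsWithin] with δ hδ using h δ hδ)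
  intro δ hδ
  obtain ⟨K, hK0, hK, hKM⟩ :=
    exists_isCompact_forall_mul_le_barrier (k := k) hδ (by positivity) M
  refine nonpos_of_transport_neg (b := b) (ψ := fun x t => w x t - δ * barrier k x t)
    isOpen_Ioi hK hK0 (hcont.sub (by unfold barrier; fun_prop))
    (fun y hy s hs => sub_nonpos.2 ((hbound y hy.1 s hs).trans (hKM y hy s hs)))
    (fun y hy => sub_nonpos.2 ((h0 y hy).trans (mul_pos hδ (barrier_pos k y 0)).le))
    (fun y hy s hs => (hx y hy s hs).sub ((hasDerivAt_barrier_space k y s).const_mul δ))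
    (fun y hy s hs => (ht y hy s hs).sub ((hasDerivAt_barrier_time k y s).const_mul δ))
    (fun y hy s hs hpos => ?_) hx0 ht0
  have hwpos : 0 < w y s := (mul_pos hδ (barrier_pos k y s)).trans (sub_pos.1 hpos)
  have hsuper := barrier_strict_supersolution (hb y hy s hs) (mem_Ioi.1 hy).le s
  linarith [hw y hy s hs hwpos, mul_pos hδ hsuper]

end MaximumPrinciple

section LaplaceTransform

variable {μ ν : Measure ℝ}

lemma norm_cexp_mul_ofReal_le_one {z : ℂ} {s : ℝ} (hz : z.re ≤ 0) (hs : 0 ≤ s) :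
    ‖Complex.exp (z * s)‖ ≤ 1 := by
  rw [Complex.norm_exp, Complex.re_mul_ofReal, Real.exp_le_one_iff]
  exact mul_nonpos_of_nonpos_of_nonneg hz hs

lemma Iic_subset_integrableExpSet [IsFiniteMeasure μ] (hμ : ∀ᵐ s ∂μ, 0 ≤ s) :
    Iic 0 ⊆ integrableExpSet id μ := by
  intro t ht
  refine (integrable_const (1 : ℝ)).mono' (by fun_prop) ?_
  filter_upwards [hμ] with s hs
  rw [Real.norm_eq_abs, Real.abs_exp, Real.exp_le_one_iff]
  exact mul_nonpos_of_nonpos_of_nonneg ht hs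

lemma continuousOn_complexMGF_re_nonpos [IsFiniteMeasure μ] (hμ : ∀ᵐ s ∂μ, 0 ≤ s) :
    ContinuousOn (complexMGF id μ) {z | z.re ≤ 0} := by
  refine continuousOn_of_dominated (bound := fun _ => 1) (fun z _ => by fun_prop)
    (fun z hz => ?_) (integrable_const 1) (ae_of_all _ fun s => by fun_prop)
  filter_upwards [hμ] with s hs using norm_cexp_mul_ofReal_le_one hz hs

lemma eqOn_complexMGF_of_mgf_eq_of_neg [IsFiniteMeasure μ] [IsFiniteMeasure ν]
    (hμ : ∀ᵐ s ∂μ, 0 ≤ s) (hν : ∀ᵐ s ∂ν, 0 ≤ s) (h : ∀ t < 0, mgf id μ t = mgf id ν t) :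
    EqOn (complexMGF id μ) (complexMGF id ν) {z | z.re < 0} := by
  have hanalytic : ∀ ρ : Measure ℝ, [IsFiniteMeasure ρ] → (∀ᵐ s ∂ρ, 0 ≤ s) →
      AnalyticOnNhd ℂ (complexMGF id ρ) {z | z.re < 0} := fun ρ _ hρ =>
    analyticOnNhd_complexMGF.mono fun z hz =>
      interior_mono (Iic_subset_integrableExpSet hρ) (by simpa using hz)
  refine (hanalytic μ hμ).eqOn_of_preconnected_of_frequently_eq (hanalytic ν hν)
    ((convex_Iio (0 : ℝ)).linear_preimage Complex.reLm).isPreconnected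
    (z₀ := ((-1 : ℝ) : ℂ)) (by simp) ?_
  have hlim : Tendsto ((↑) : ℝ → ℂ) (𝓝[≠] (-1)) (𝓝[≠] ((-1 : ℝ) : ℂ)) :=
    Complex.continuous_ofReal.continuousAt.continuousWithinAt.tendsto_nhdsWithin
      fun t ht => Complex.ofReal_injective.ne ht
  refine hlim.frequently (Eventually.frequently ?_)
  filter_upwards [mem_nhdsWithin_of_mem_nhds (Iio_mem_nhds (show (-1 : ℝ) < 0 by norm_num))]
    with t ht
  rw [complexMGF_ofReal, complexMGF_ofReal, h t ht]

lemma eq_of_mgf_eq_of_neg [IsFiniteMeasure μ] [IsFiniteMeasure ν]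
    (hμ : ∀ᵐ s ∂μ, 0 ≤ s) (hν : ∀ᵐ s ∂ν, 0 ≤ s) (h : ∀ t < 0, mgf id μ t = mgf id ν t) :
    μ = ν := by
  have heq : EqOn (complexMGF id μ) (complexMGF id ν) {z | z.re ≤ 0} :=
    (eqOn_complexMGF_of_mgf_eq_of_neg hμ hν h).of_subset_closure
      (continuousOn_complexMGF_re_nonpos hμ) (continuousOn_complexMGF_re_nonpos hν)
      (fun z (hz : z.re < 0) => hz.le) (Complex.closure_setOfPred_re_lt 0).ge
  refine Measure.ext_of_charFun (funext fun t => ?_)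
  rw [← complexMGF_id_mul_I, ← complexMGF_id_mul_I]
  exact heq (by simp)

end LaplaceTransform

section BernsteinTransform

/-- The first moment `m₁ = ∫₀^∞ s μ(ds)` as a real number; it is the total mass when that is
finite, and `0` by convention otherwise. -/
noncomputable def firstMoment (μ : Measure ℝ) : ℝ :=
  ∫ s in Ioi (0 : ℝ), s ∂μ

/-- The Bernstein transform `U(x) = ∫₀^∞ (1 - e^{-xs}) μ(ds)` of the part of `μ` on `(0,∞)`, the
unknown in which the coagulation-fragmentation equation becomes a first-order equation. -/
noncomputable def bernstein (μ : Measure ℝ) (x : ℝ) : ℝ :=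
  ∫ s in Ioi (0 : ℝ), (1 - Real.exp (-(x * s))) ∂μ

/-- The derivative `U'(x)` of the Bernstein transform for `x > 0`, written as the Laplace transform
of `s μ(ds)`. -/
noncomputable def bernsteinDeriv (μ : Measure ℝ) (x : ℝ) : ℝ :=
  ∫ s in Ioi (0 : ℝ), s * Real.exp (-(x * s)) ∂μ

/-- The size-biased measure `s μ(ds)` on `(0,∞)`, finite when `μ` has finite mass. -/
noncomputable def sizeBiased (μ : Measure ℝ) : Measure ℝ :=
  (μ.restrict (Ioi 0)).withDensity ENNReal.ofReal

variable {μ ν : Measure ℝ} {x s : ℝ}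

lemma hasDerivAt_one_sub_exp_neg_mul (x s : ℝ) :
    HasDerivAt (fun r => 1 - Real.exp (-(x * r))) (x * Real.exp (-(x * s))) s := by
  simpa [mul_comm] using (((hasDerivAt_id s).const_mul x).fun_neg).exp.const_sub 1

lemma exp_neg_mul_le_one (hx : 0 ≤ x) (hs : 0 ≤ s) : Real.exp (-(x * s)) ≤ 1 :=
  Real.exp_le_one_iff.2 (neg_nonpos.2 (mul_nonneg hx hs))

lemma norm_mul_exp_neg_mul_le (hx : 0 ≤ x) (hs : 0 ≤ s) : ‖s * Real.exp (-(x * s))‖ ≤ s := by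
  rw [Real.norm_eq_abs, abs_of_nonneg (by positivity)]
  exact mul_le_of_le_one_right hs (exp_neg_mul_le_one hx hs)

lemma isTestFunction_one_sub_exp (hx : 0 ≤ x) :
    IsTestFunction (fun s => 1 - Real.exp (-(x * s))) where
  continuousOn := by fun_prop
  bounded := by
    refine ⟨1, fun s hs => abs_le.2 ⟨?_, ?_⟩⟩
    · linarith [exp_neg_mul_le_one hx (mem_Ici.1 hs)]
    · linarith [Real.exp_pos (-(x * s))]
  lipschitz := by
    refine ⟨x.toNNReal, (convex_Ici 0).lipschitzOnWith_of_nnnorm_hasDerivWithin_le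
      (fun s _ => (hasDerivAt_one_sub_exp_neg_mul x s).hasDerivWithinAt) fun s hs => ?_⟩
    rw [← NNReal.coe_le_coe, coe_nnnorm, Real.coe_toNNReal x hx, mul_comm x s]
    exact norm_mul_exp_neg_mul_le hs hx
  map_zero := by simp

lemma bernstein_nonneg (hx : 0 ≤ x) : 0 ≤ bernstein μ x :=
  setIntegral_nonneg measurableSet_Ioi fun _ hs =>
    sub_nonneg.2 (exp_neg_mul_le_one hx (mem_Ioi.1 hs).le)

lemma bernsteinDeriv_nonneg : 0 ≤ bernsteinDeriv μ x :=
  setIntegral_nonneg measurableSet_Ioi fun _ hs => mul_nonneg (mem_Ioi.1 hs).le (Real.exp_nonneg _)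

lemma integrableOn_mul_exp (h : IntegrableOn (fun s => s) (Ioi 0) μ) (hx : 0 ≤ x) :
    IntegrableOn (fun s => s * Real.exp (-(x * s))) (Ioi 0) μ := by
  refine h.mono' (by fun_prop) ?_
  filter_upwards [ae_restrict_mem measurableSet_Ioi] with s hs
  exact norm_mul_exp_neg_mul_le hx (mem_Ioi.1 hs).le

lemma bernsteinDeriv_le_firstMoment (h : IntegrableOn (fun s => s) (Ioi 0) μ) (hx : 0 ≤ x) :
    bernsteinDeriv μ x ≤ firstMoment μ :=
  setIntegral_mono_on (integrableOn_mul_exp h hx) h measurableSet_Ioi fun _ hs =>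
    (le_abs_self _).trans (norm_mul_exp_neg_mul_le hx (mem_Ioi.1 hs).le)

lemma one_sub_exp_neg_mul_le (x s : ℝ) : 1 - Real.exp (-(x * s)) ≤ x * s := by
  linarith [Real.one_sub_le_exp_neg (x * s)]

lemma integrableOn_one_sub_exp (h : IntegrableOn (fun s => s) (Ioi 0) μ) (hx : 0 ≤ x) :
    IntegrableOn (fun s => 1 - Real.exp (-(x * s))) (Ioi 0) μ := by
  refine (h.const_mul x).mono' (by fun_prop) ?_
  filter_upwards [ae_restrict_mem measurableSet_Ioi] with s hs
  rw [Real.norm_eq_abs, abs_of_nonneg (sub_nonneg.2 (exp_neg_mul_le_one hx (mem_Ioi.1 hs).le))]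
  exact one_sub_exp_neg_mul_le x s

lemma bernstein_le (h : IntegrableOn (fun s => s) (Ioi 0) μ) (hx : 0 ≤ x) :
    bernstein μ x ≤ firstMoment μ * x := by
  rw [mul_comm, firstMoment, ← integral_const_mul]
  exact integral_mono (integrableOn_one_sub_exp h hx) (h.const_mul x) (one_sub_exp_neg_mul_le x)

lemma hasDerivAt_bernstein (h : IntegrableOn (fun s => s) (Ioi 0) μ) (hx : 0 < x) :
    HasDerivAt (bernstein μ) (bernsteinDeriv μ x) x := by
  refine (hasDerivAt_integral_of_dominated_loc_of_deriv_le (s := Ioi 0) (bound := fun s => s)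
    (F := fun x s => 1 - Real.exp (-(x * s))) (F' := fun x s => s * Real.exp (-(x * s)))
    (Ioi_mem_nhds hx) (Eventually.of_forall fun y => by fun_prop)
    (integrableOn_one_sub_exp h hx.le) (by fun_prop) ?_ h ?_).2
  · filter_upwards [ae_restrict_mem measurableSet_Ioi] with s hs y hy
    exact norm_mul_exp_neg_mul_le (mem_Ioi.1 hy).le (mem_Ioi.1 hs).le
  · refine ae_of_all _ fun s y _ => ?_
    simpa only [mul_comm] using hasDerivAt_one_sub_exp_neg_mul s y

lemma lipschitzOnWith_bernstein (h : IntegrableOn (fun s => s) (Ioi 0) μ) :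
    LipschitzOnWith (firstMoment μ).toNNReal (bernstein μ) (Ioi 0) := by
  refine (convex_Ioi 0).lipschitzOnWith_of_nnnorm_hasDerivWithin_le
    (fun x hx => (hasDerivAt_bernstein h hx).hasDerivWithinAt) fun x hx => ?_
  rw [← NNReal.coe_le_coe, coe_nnnorm, Real.norm_eq_abs, abs_of_nonneg bernsteinDeriv_nonneg]
  exact (bernsteinDeriv_le_firstMoment h (mem_Ioi.1 hx).le).trans (Real.le_coe_toNNReal _)

lemma mgf_sizeBiased (μ : Measure ℝ) (t : ℝ) :
    mgf id (sizeBiased μ) t = bernsteinDeriv μ (-t) := by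
  rw [mgf, sizeBiased, integral_withDensity_eq_integral_toReal_smul (by fun_prop) (by simp)]
  refine setIntegral_congr_fun measurableSet_Ioi fun s hs => ?_
  simp [ENNReal.toReal_ofReal (mem_Ioi.1 hs).le]

lemma ae_sizeBiased_nonneg (μ : Measure ℝ) : ∀ᵐ s ∂(sizeBiased μ), 0 ≤ s := by
  refine (withDensity_absolutelyContinuous _ _).ae_le ?_
  filter_upwards [ae_restrict_mem measurableSet_Ioi] with s hs using (mem_Ioi.1 hs).le

lemma withDensity_inv_sizeBiased (hμ : μ (Iic 0) = 0) :
    (sizeBiased μ).withDensity (fun s => (ENNReal.ofReal s)⁻¹) = μ := by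
  have hpos : ∀ᵐ s ∂μ, s ∈ Ioi 0 := by
    rw [← compl_Ioi] at hμ
    exact hμ
  rw [sizeBiased, Measure.restrict_eq_self_of_ae_mem hpos,
    withDensity_inv_same (by fun_prop) _ (by simp)]
  filter_upwards [hpos] with s hs using (ENNReal.ofReal_pos.2 hs).ne'

lemma eq_of_bernstein_eq (hμ : μ (Iic 0) = 0) (hν : ν (Iic 0) = 0)
    (hμi : IntegrableOn (fun s => s) (Ioi 0) μ) (hνi : IntegrableOn (fun s => s) (Ioi 0) ν)
    (h : ∀ x, 0 < x → bernstein μ x = bernstein ν x) : μ = ν := by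
  have : IsFiniteMeasure (sizeBiased μ) := isFiniteMeasure_withDensity_ofReal hμi.2
  have : IsFiniteMeasure (sizeBiased ν) := isFiniteMeasure_withDensity_ofReal hνi.2
  have hderiv : ∀ x, 0 < x → bernsteinDeriv μ x = bernsteinDeriv ν x := fun x hx =>
    (hasDerivAt_bernstein hμi hx).unique ((hasDerivAt_bernstein hνi hx).congr_of_eventuallyEq
      (by filter_upwards [Ioi_mem_nhds hx] with y hy using h y hy))
  have hbiased : sizeBiased μ = sizeBiased ν := by
    refine eq_of_mgf_eq_of_neg (ae_sizeBiased_nonneg μ) (ae_sizeBiased_nonneg ν) fun t ht => ?_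
    rw [mgf_sizeBiased, mgf_sizeBiased, hderiv _ (neg_pos.2 ht)]
  rw [← withDensity_inv_sizeBiased hμ, hbiased, withDensity_inv_sizeBiased hν]

end BernsteinTransform

section WeakEquation

lemma integral_coagulation_one_sub_exp {μ : Measure ℝ} {x : ℝ}
    (h : IntegrableOn (fun s => s) (Ioi 0) μ) (hx : 0 ≤ x) :
    ∫ s in Ioi (0 : ℝ), ∫ r in Ioi (0 : ℝ), ((1 - Real.exp (-(x * (s + r))))
      - (1 - Real.exp (-(x * s))) - (1 - Real.exp (-(x * r)))) * (s * r) ∂μ ∂μ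
      = -(firstMoment μ - bernsteinDeriv μ x) ^ 2 := by
  have hfactor : ∀ s r : ℝ, ((1 - Real.exp (-(x * (s + r)))) - (1 - Real.exp (-(x * s)))
      - (1 - Real.exp (-(x * r)))) * (s * r)
      = -((s - s * Real.exp (-(x * s))) * (r - r * Real.exp (-(x * r)))) := by
    intro s r
    rw [mul_add, neg_add, Real.exp_add]
    ring
  have hintegral : ∫ r in Ioi (0 : ℝ), (r - r * Real.exp (-(x * r))) ∂μ
      = firstMoment μ - bernsteinDeriv μ x := integral_sub h (integrableOn_mul_exp h hx)
  simp only [hfactor, integral_neg, integral_const_mul, integral_mul_const, hintegral]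
  ring

lemma integral_sub_sub_comp_sub_left {φ : ℝ → ℝ} (hφ : Continuous φ) (s : ℝ) :
    ∫ r in (0 : ℝ)..s, (φ s - φ r - φ (s - r)) = s * φ s - 2 * ∫ r in (0 : ℝ)..s, φ r := by
  have hint : ∀ f : ℝ → ℝ, Continuous f → IntervalIntegrable f volume 0 s :=
    fun f hf => hf.intervalIntegrable 0 s
  rw [intervalIntegral.integral_sub (hint _ (by fun_prop)) (hint _ (by fun_prop)),
    intervalIntegral.integral_sub (hint _ (by fun_prop)) (hint _ hφ),
    intervalIntegral.integral_comp_sub_left φ s]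
  simp only [intervalIntegral.integral_const, smul_eq_mul, sub_self, sub_zero]
  ring

lemma intervalIntegral_one_sub_exp {x : ℝ} (hx : x ≠ 0) (s : ℝ) :
    ∫ r in (0 : ℝ)..s, (1 - Real.exp (-(x * r))) = s - (1 - Real.exp (-(x * s))) / x := by
  have hexp : ∫ r in (0 : ℝ)..s, Real.exp (-(x * r)) = (1 - Real.exp (-(x * s))) / x := by
    simp only [← neg_mul]
    rw [intervalIntegral.integral_comp_mul_left Real.exp (neg_ne_zero.2 hx), integral_exp]
    simp only [mul_zero, Real.exp_zero, smul_eq_mul]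
    field_simp
    ring
  rw [intervalIntegral.integral_sub (by simp)
    (Continuous.intervalIntegrable (by fun_prop) 0 s), hexp]
  simp

lemma integral_fragmentation_one_sub_exp {μ : Measure ℝ} {x : ℝ}
    (h : IntegrableOn (fun s => s) (Ioi 0) μ) (hx : 0 < x) :
    ∫ s in Ioi (0 : ℝ), (∫ r in (0 : ℝ)..s, ((1 - Real.exp (-(x * s)))
      - (1 - Real.exp (-(x * r))) - (1 - Real.exp (-(x * (s - r)))))) ∂μ
      = 2 / x * bernstein μ x - firstMoment μ - bernsteinDeriv μ x := by
  have hinner : ∀ s : ℝ, ∫ r in (0 : ℝ)..s, ((1 - Real.exp (-(x * s)))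
      - (1 - Real.exp (-(x * r))) - (1 - Real.exp (-(x * (s - r)))))
      = 2 / x * (1 - Real.exp (-(x * s))) - s - s * Real.exp (-(x * s)) := by
    intro s
    rw [integral_sub_sub_comp_sub_left (φ := fun s => 1 - Real.exp (-(x * s))) (by fun_prop),
      intervalIntegral_one_sub_exp hx.ne']
    ring
  have hbernstein := (integrableOn_one_sub_exp h hx.le).const_mul (2 / x)
  have hdiff : IntegrableOn (fun s => 2 / x * (1 - Real.exp (-(x * s))) - s) (Ioi 0) μ :=
    hbernstein.sub h
  simp only [hinner]
  rw [integral_sub hdiff (integrableOn_mul_exp h hx.le), integral_sub hbernstein h,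
    integral_const_mul]
  rfl

lemma measureWeakRHS_one_sub_exp {μ : ℝ → Measure ℝ} {t x : ℝ}
    (h : IntegrableOn (fun s => s) (Ioi 0) (μ t)) (hx : 0 < x) :
    measureWeakRHS μ (fun s => 1 - Real.exp (-(x * s))) t
      = -(1 / 2) * (firstMoment (μ t) - bernsteinDeriv (μ t) x) ^ 2
        + (1 / 2) * (firstMoment (μ t) + bernsteinDeriv (μ t) x) - bernstein (μ t) x / x := by
  rw [measureWeakRHS, integral_coagulation_one_sub_exp h hx.le,
    integral_fragmentation_one_sub_exp h hx]
  ring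

end WeakEquation

section MeasureSolutions

variable {μ ν : ℝ → Measure ℝ} {t x : ℝ}

lemma IsMeasureSolution.integrableOn (h : IsMeasureSolution μ) (ht : 0 ≤ t) :
    IntegrableOn (fun s => s) (Ioi 0) (μ t) := by
  refine ⟨by fun_prop, (hasFiniteIntegral_iff_ofReal ?_).2 (h.mass_ne_top t ht).lt_top⟩
  filter_upwards [ae_restrict_mem measurableSet_Ioi] with s hs using (mem_Ioi.1 hs).le

lemma firstMoment_eq_toReal_measureMass (μ : ℝ → Measure ℝ) (t : ℝ) :
    firstMoment (μ t) = (measureMass μ t).toReal := by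
  refine integral_eq_lintegral_of_nonneg_ae ?_ (by fun_prop)
  filter_upwards [ae_restrict_mem measurableSet_Ioi] with s hs using (mem_Ioi.1 hs).le

lemma IsMassConservingMeasureSolution.firstMoment_eq (h : IsMassConservingMeasureSolution μ)
    (ht : 0 ≤ t) : firstMoment (μ t) = firstMoment (μ 0) := by
  rw [firstMoment_eq_toReal_measureMass, firstMoment_eq_toReal_measureMass, h.mass_eq t ht]

lemma IsMassConservingMeasureSolution.hasDerivAt_bernstein_time
    (h : IsMassConservingMeasureSolution μ) (hx : 0 < x) (ht : 0 < t) :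
    HasDerivAt (fun τ => bernstein (μ τ) x)
      (-(1 / 2) * (firstMoment (μ 0) - bernsteinDeriv (μ t) x) ^ 2
        + (1 / 2) * (firstMoment (μ 0) + bernsteinDeriv (μ t) x) - bernstein (μ t) x / x) t := by
  rw [← h.firstMoment_eq ht.le, ← measureWeakRHS_one_sub_exp (h.integrableOn ht.le) hx]
  exact h.hasDerivAt _ (isTestFunction_one_sub_exp hx.le) t ht

lemma IsMeasureSolution.continuousOn_bernstein_time (h : IsMeasureSolution μ) (hx : 0 ≤ x) :
    ContinuousOn (fun t => bernstein (μ t) x) (Ici 0) := by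
  have hφ := isTestFunction_one_sub_exp hx
  intro t ht
  rcases (mem_Ici.1 ht).eq_or_lt with rfl | ht
  · exact h.continuous_at_zero _ hφ
  · exact (h.hasDerivAt _ hφ t ht).continuousAt.continuousWithinAt

lemma IsMassConservingMeasureSolution.continuousOn_bernstein
    (h : IsMassConservingMeasureSolution μ) :
    ContinuousOn (fun p : ℝ × ℝ => bernstein (μ p.2) p.1) (Ioi 0 ×ˢ Ici 0) := by
  refine continuousOn_prod_of_continuousOn_lipschitzOnWith _ (firstMoment (μ 0)).toNNReal
    (fun x hx => h.continuousOn_bernstein_time (mem_Ioi.1 hx).le) fun t ht => ?_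
  rw [← h.firstMoment_eq ht]
  exact lipschitzOnWith_bernstein (h.integrableOn ht)

lemma IsMassConservingMeasureSolution.bernstein_le_bernstein
    (hμ : IsMassConservingMeasureSolution μ) (hν : IsMassConservingMeasureSolution ν)
    (h0 : μ 0 = ν 0) (hx : 0 < x) (ht : 0 ≤ t) : bernstein (μ t) x ≤ bernstein (ν t) x := by
  set m := firstMoment (μ 0) with hm
  rw [← sub_nonpos]
  refine nonpos_of_transport_nonpos (M := m) (B := m + 1 / 2)
    (w := fun x t => bernstein (μ t) x - bernstein (ν t) x)
    (b := fun x t => (bernsteinDeriv (μ t) x + bernsteinDeriv (ν t) x) / 2 - m - 1 / 2)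
    (hμ.continuousOn_bernstein.sub hν.continuousOn_bernstein) ?_ (by simp [h0])
    (fun x hx t ht => (hasDerivAt_bernstein (hμ.integrableOn ht.le) hx).sub
      (hasDerivAt_bernstein (hν.integrableOn ht.le) hx))
    (fun x hx t ht => (hμ.hasDerivAt_bernstein_time hx ht).sub
      (hν.hasDerivAt_bernstein_time hx ht)) ?_ ?_ hx ht
  · intro x hx t ht
    have hle : bernstein (μ t) x ≤ m * x := by
      rw [hm, ← hμ.firstMoment_eq ht]
      exact bernstein_le (hμ.integrableOn ht) hx.le
    linarith [bernstein_nonneg (μ := ν t) hx.le]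
  · intro x _ t _
    linarith [bernsteinDeriv_nonneg (μ := μ t) (x := x), bernsteinDeriv_nonneg (μ := ν t) (x := x)]
  · intro x hx t _ hw
    have hdamping : 0 < (bernstein (μ t) x - bernstein (ν t) x) / x := div_pos hw hx
    rw [← h0, ← hm]
    linear_combination hdamping

theorem IsMassConservingMeasureSolution.unique (hμ : IsMassConservingMeasureSolution μ)
    (hν : IsMassConservingMeasureSolution ν) (h0 : μ 0 = ν 0) (ht : 0 ≤ t) : μ t = ν t :=
  eq_of_bernstein_eq (hμ.concentrated t ht) (hν.concentrated t ht) (hμ.integrableOn ht)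
    (hν.integrableOn ht) fun _ hx => le_antisymm (hμ.bernstein_le_bernstein hν h0 hx ht)
      (hν.bernstein_le_bernstein hμ h0.symm hx ht)

end MeasureSolutions

section Densities

/-- The measures `c(s,t) ds` on `(0,∞)`, through which a solution is also a solution in the measure
sense; negative values of `c` are replaced by `0`. -/
noncomputable def densityMeasure (c : ℝ → ℝ → ℝ) (t : ℝ) : Measure ℝ :=
  (volume.restrict (Ioi 0)).withDensity (fun s => ENNReal.ofReal (c s t))

variable {c d : ℝ → ℝ → ℝ} {t : ℝ}

lemma densityMeasure_restrict (c : ℝ → ℝ → ℝ) (t : ℝ) :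
    (densityMeasure c t).restrict (Ioi 0) = densityMeasure c t := by
  rw [densityMeasure, restrict_withDensity measurableSet_Ioi,
    Measure.restrict_restrict measurableSet_Ioi, inter_self]

lemma IsSolution.setIntegral_densityMeasure (h : IsSolution c) (ht : 0 ≤ t) (g : ℝ → ℝ) :
    ∫ s in Ioi (0 : ℝ), g s ∂(densityMeasure c t) = ∫ s in Ioi (0 : ℝ), g s * c s t := by
  rw [densityMeasure_restrict, densityMeasure, integral_withDensity_eq_integral_toReal_smul₀
    (h.aemeasurable t ht).ennreal_ofReal (by simp)]
  refine integral_congr_ae ?_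
  filter_upwards [h.nonneg t ht] with s hs
  rw [ENNReal.toReal_ofReal hs, smul_eq_mul, mul_comm]

lemma IsSolution.measureMass_densityMeasure (h : IsSolution c) (ht : 0 ≤ t) :
    measureMass (densityMeasure c) t = mass c t := by
  rw [measureMass, densityMeasure_restrict, densityMeasure,
    lintegral_withDensity_eq_lintegral_mul₀ (h.aemeasurable t ht).ennreal_ofReal (by fun_prop)]
  refine setLIntegral_congr_fun measurableSet_Ioi fun s hs => ?_
  rw [Pi.mul_apply, mul_comm, ENNReal.ofReal_mul (mem_Ioi.1 hs).le]

lemma IsSolution.measureWeakRHS_densityMeasure (h : IsSolution c) (ht : 0 ≤ t) (φ : ℝ → ℝ) :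
    measureWeakRHS (densityMeasure c) φ t = weakRHS c φ t := by
  simp only [measureWeakRHS, weakRHS, h.setIntegral_densityMeasure ht, ← integral_mul_const]
  congr 4 with s
  congr 1 with r
  ring

lemma measure_ne_top_of_lintegral_ofReal_ne_top {μ : Measure ℝ}
    (h : ∫⁻ s in Ioi (0 : ℝ), ENNReal.ofReal s ∂μ ≠ ⊤) {K : Set ℝ} (hK : K ⊆ Ioi 0)
    (hKc : IsCompact K) : μ K ≠ ⊤ := by
  rcases K.eq_empty_or_nonempty with rfl | hne
  · simp
  obtain ⟨a, haK, ha⟩ := hKc.exists_isLeast hne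
  have hle : ENNReal.ofReal a * μ K ≤ ∫⁻ s in Ioi (0 : ℝ), ENNReal.ofReal s ∂μ := by
    rw [← setLIntegral_const]
    exact (setLIntegral_mono (by fun_prop) fun s hs => ENNReal.ofReal_le_ofReal (ha hs)).trans
      (lintegral_mono_set hK)
  exact (ENNReal.lt_top_of_mul_ne_top_right (ne_top_of_le_ne_top h hle)
    (ENNReal.ofReal_pos.2 (hK haK)).ne').ne

lemma IsSolution.isMeasureSolution (h : IsSolution c) : IsMeasureSolution (densityMeasure c) where
  concentrated t _ := by
    rw [← densityMeasure_restrict, Measure.restrict_apply measurableSet_Iic, ← compl_Ioi,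
      compl_inter_self, measure_empty]
  finite_on_compacts t ht K hK hKc :=
    measure_ne_top_of_lintegral_ofReal_ne_top
      ((h.measureMass_densityMeasure ht).trans_ne (h.mass_ne_top t ht)) hK hKc
  mass_ne_top t ht := (h.measureMass_densityMeasure ht).trans_ne (h.mass_ne_top t ht)
  hasDerivAt φ hφ t ht := by
    rw [h.measureWeakRHS_densityMeasure ht.le]
    refine (h.hasDerivAt φ hφ t ht).congr_of_eventuallyEq ?_
    filter_upwards [Ioi_mem_nhds ht] with τ hτ
    exact h.setIntegral_densityMeasure (mem_Ioi.1 hτ).le φ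
  continuous_at_zero φ hφ :=
    (h.continuous_at_zero φ hφ).congr (fun τ hτ => h.setIntegral_densityMeasure hτ φ)
      (h.setIntegral_densityMeasure le_rfl φ)

lemma IsMassConservingSolution.isMassConservingMeasureSolution (h : IsMassConservingSolution c) :
    IsMassConservingMeasureSolution (densityMeasure c) where
  toIsMeasureSolution := h.isMeasureSolution
  mass_eq t ht := by
    rw [h.measureMass_densityMeasure ht, h.measureMass_densityMeasure le_rfl, h.mass_eq t ht]

lemma IsSolution.densityMeasure_eq_iff (hc : IsSolution c) (hd : IsSolution d) (ht : 0 ≤ t) :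
    densityMeasure c t = densityMeasure d t ↔
      ∀ᵐ s ∂(volume.restrict (Ioi (0 : ℝ))), c s t = d s t := by
  rw [densityMeasure, densityMeasure, withDensity_eq_iff_of_sigmaFinite
    (hc.aemeasurable t ht).ennreal_ofReal (hd.aemeasurable t ht).ennreal_ofReal]
  refine eventually_congr ?_
  filter_upwards [hc.nonneg t ht, hd.nonneg t ht] with s hcs hds
  exact ENNReal.ofReal_eq_ofReal_iff hcs hds

theorem IsMassConservingSolution.unique (hc : IsMassConservingSolution c)
    (hd : IsMassConservingSolution d)
    (h0 : ∀ᵐ s ∂(volume.restrict (Ioi (0 : ℝ))), c s 0 = d s 0) (ht : 0 ≤ t) :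
    ∀ᵐ s ∂(volume.restrict (Ioi (0 : ℝ))), c s t = d s t :=
  (hc.densityMeasure_eq_iff hd.toIsSolution ht).1 <|
    hc.isMassConservingMeasureSolution.unique hd.isMassConservingMeasureSolution
      ((hc.densityMeasure_eq_iff hd.toIsSolution le_rfl).2 h0) ht

end Densities

end CoagFrag

theorem corollary1p2_general :
    (∀ c d : ℝ → ℝ → ℝ,
      CoagFrag.IsMassConservingSolution c → CoagFrag.IsMassConservingSolution d →
      (∀ᵐ s ∂(volume.restrict (Ioi (0 : ℝ))), c s 0 = d s 0) →
      ∀ t, 0 ≤ t → ∀ᵐ s ∂(volume.restrict (Ioi (0 : ℝ))), c s t = d s t) ∧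
    (∀ μ ν : ℝ → Measure ℝ,
      CoagFrag.IsMassConservingMeasureSolution μ → CoagFrag.IsMassConservingMeasureSolution ν →
      μ 0 = ν 0 →
      ∀ t, 0 ≤ t → μ t = ν t) :=
  ⟨fun _ _ hc hd h0 _ ht => hc.unique hd h0 ht, fun _ _ hμ hν h0 _ ht => hμ.unique hν h0 ht⟩

theorem corollary1p2 (m : ℝ) (hm0 : 0 < m) (hm1 : m ≤ 1) :
    (∀ c d : ℝ → ℝ → ℝ,
      CoagFrag.IsMassConservingSolution c → CoagFrag.IsMassConservingSolution d →
      CoagFrag.mass c 0 = ENNReal.ofReal m →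
      (∀ᵐ s ∂(volume.restrict (Ioi (0 : ℝ))), c s 0 = d s 0) →
      ∀ t, 0 ≤ t → ∀ᵐ s ∂(volume.restrict (Ioi (0 : ℝ))), c s t = d s t) ∧
    (∀ μ ν : ℝ → Measure ℝ,
      CoagFrag.IsMassConservingMeasureSolution μ → CoagFrag.IsMassConservingMeasureSolution ν →
      CoagFrag.measureMass μ 0 = ENNReal.ofReal m →
      μ 0 = ν 0 →
      ∀ t, 0 ≤ t → μ t = ν t) :=
  ⟨fun c d hc hd _ => corollary1p2_general.1 c d hc hd,
    fun μ ν hμ hν _ => corollary1p2_general.2 μ ν hμ hν⟩
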